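/- Let $r\ge 1$ be an integer, let $[2r]=\{1,\dots,2r\}$, and order $P=[2r]\times[2r]\times[2r]$ componentwise. For $a=(a_1,a_2,a_3)\in P$ put $\varphi(a)=(2r+1-a_1,\,2r+1-a_2,\,2r+1-a_3)$ and let $\mathcal O(a)=\{(a_1,a_2,a_3),(a_2,a_3,a_1),(a_3,a_1,a_2)\}$. A CSSC (cyclically symmetric self-complementary) ideal is a down-closed set $I\subseteq P$ such that, for every $a\in P$, $a\in I\iff\varphi(a)\notin I$, and $a\in I$ implies $\mathcal O(a)\subseteq I$. Let $G_{C_3}(2r,2r,2r)$ be the graph whose vertices are the CSSC ideals, in which two distinct CSSC ideals $I,J$ are adjacent if there is a point $a\in I$ with $J=(I\setminus\mathcal O(a))\cup\varphi(\mathcal O(a))$, and let $C_{2r}=\{a\in P: a_1+a_2+a_3\le 3r+1\}$, which is a CSSC ideal. Then $G_{C_3}(2r,2r,2r)$ is connected, the maximal graph distance from $C_{2r}$ to a CSSC ideal is $\frac16(r-1)r(r+1)$, and exactly $3^{r-1}$ CSSC ideals lie at this distance from $C_{2r}$. -/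

import Mathlib

/-- The product of three chains `[2r] × [2r] × [2r]` with the componentwise order.
The element `i : Fin (2 * r)` stands for the element `i + 1` of the chain `{1, …, 2r}`. -/
abbrev Cube (r : ℕ) : Type := Fin (2 * r) × Fin (2 * r) × Fin (2 * r)

namespace Cube

/-- The order-reversing involution; in coordinates from `1` to `2r` it is
`(a₁, a₂, a₃) ↦ (2r + 1 - a₁, 2r + 1 - a₂, 2r + 1 - a₃)`. -/
def dual {r : ℕ} (a : Cube r) : Cube r := (a.1.rev, a.2.1.rev, a.2.2.rev)

/-- The cyclic shift `(a₁, a₂, a₃) ↦ (a₂, a₃, a₁)`. -/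
def rot {r : ℕ} (a : Cube r) : Cube r := (a.2.1, a.2.2, a.1)

/-- The three points `(a₁, a₂, a₃)`, `(a₂, a₃, a₁)`, `(a₃, a₁, a₂)`. -/
def orbit {r : ℕ} (a : Cube r) : Set (Cube r) := {a, rot a, rot (rot a)}

theorem dual_dual {r : ℕ} (a : Cube r) : dual (dual a) = a := by
  simp [dual]

end Cube

/-- A cyclically symmetric self-complementary (CSSC) ideal of `[2r] × [2r] × [2r]`.
Ideals are lower sets; the empty set is not excluded. -/
structure CSSCIdeal (r : ℕ) where
  ideal : LowerSet (Cube r)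
  selfComplementary : ∀ a : Cube r, a ∈ ideal ↔ a.dual ∉ ideal
  cyclicallySymmetric : ∀ a : Cube r, a ∈ ideal → a.rot ∈ ideal ∧ a.rot.rot ∈ ideal

namespace CSSCIdeal

/-- `I` and `J` are distinct, and replacing `a`, `rot a`, `rot (rot a)` in `I` by their duals,
for some point `a` of `I`, yields `J`. -/
def IsFlip {r : ℕ} (I J : CSSCIdeal r) : Prop :=
  I ≠ J ∧ ∃ a ∈ I.ideal,
    (J.ideal : Set (Cube r)) = ((I.ideal : Set (Cube r)) \ a.orbit) ∪ Cube.dual '' a.orbit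

theorem IsFlip.symm {r : ℕ} {I J : CSSCIdeal r} (h : IsFlip I J) : IsFlip J I := by
  obtain ⟨hne, a, ha, hJ⟩ := h
  have hsub : ∀ x ∈ a.orbit, x ∈ I.ideal := by
    rintro x (rfl | rfl | rfl)
    · exact ha
    · exact (I.cyclicallySymmetric a ha).1
    · exact (I.cyclicallySymmetric a ha).2
  have horb : a.dual.orbit = Cube.dual '' a.orbit := by
    simp [Cube.orbit, Set.image_insert_eq, Cube.rot, Cube.dual]
  have himg : Cube.dual '' a.dual.orbit = a.orbit := by
    rw [horb, Set.image_image]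
    simp [Cube.dual_dual]
  refine ⟨hne.symm, a.dual, ?_, ?_⟩
  · have : a.dual ∈ (J.ideal : Set (Cube r)) := by
      rw [hJ]
      exact Or.inr ⟨a, Or.inl rfl, rfl⟩
    exact this
  · rw [himg, horb, hJ]
    ext x
    constructor
    · intro hx
      by_cases hxo : x ∈ a.orbit
      · exact Or.inr hxo
      · refine Or.inl ⟨Or.inl ⟨hx, hxo⟩, ?_⟩
        rintro ⟨y, hy, rfl⟩
        exact (I.selfComplementary y).1 (hsub y hy) hx
    · rintro (⟨(hx | hx), hn⟩ | hx)
      · exact hx.1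
      · exact absurd hx hn
      · exact hsub x hx

/-- The flip graph `G_{C₃}(2r, 2r, 2r)` on the CSSC ideals of `[2r] × [2r] × [2r]`. -/
def flipGraph (r : ℕ) : SimpleGraph (CSSCIdeal r) where
  Adj := IsFlip
  symm := ⟨fun _ _ h => h.symm⟩
  loopless := ⟨fun _ h => h.1 rfl⟩

/-- The ideal `C_{2r} = {(a₁, a₂, a₃) | a₁ + a₂ + a₃ ≤ 3r + 1}`, the coordinates `aᵢ` running
from `1` to `2r`. -/
def center (r : ℕ) : CSSCIdeal r where
  ideal :=
    { carrier := {a | ((a.1 : ℕ) + 1) + ((a.2.1 : ℕ) + 1) + ((a.2.2 : ℕ) + 1) ≤ 3 * r + 1}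
      lower' := by
        rintro ⟨a, b, c⟩ ⟨a', b', c'⟩ ⟨h1, h2, h3⟩ h
        change (a : ℕ) + 1 + (b + 1) + (c + 1) ≤ 3 * r + 1 at h
        change (a' : ℕ) + 1 + (b' + 1) + (c' + 1) ≤ 3 * r + 1
        simp only [Fin.le_def] at h1 h2 h3
        omega }
  selfComplementary := by
    rintro ⟨a, b, c⟩
    change (a : ℕ) + 1 + (b + 1) + (c + 1) ≤ 3 * r + 1 ↔
      ¬ ((a.rev : ℕ) + 1 + (b.rev + 1) + (c.rev + 1) ≤ 3 * r + 1)
    simp only [Fin.val_rev]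
    omega
  cyclicallySymmetric := by
    rintro ⟨a, b, c⟩ h
    change (a : ℕ) + 1 + (b + 1) + (c + 1) ≤ 3 * r + 1 at h
    change (b : ℕ) + 1 + (c + 1) + (a + 1) ≤ 3 * r + 1 ∧
      (c : ℕ) + 1 + (a + 1) + (b + 1) ≤ 3 * r + 1
    omega

end CSSCIdeal

open Finset

/-! An ideal `I` is encoded by its defect `C \ I`; self-complementarity recovers the rest. A flip
adds at most one rotation orbit to the defect, and removing an orbit of least coordinate sum is a
flip towards `C`. So the graph is connected and the distance from `C` is the number of orbits in the
defect (`dist_center`).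

To bound this number, split the orbits by the shell `k` (the boundary of `[1 - k, k]³`) and by the
coordinate sum `1 - t`. Each such ring is a cycle of `2k - 1` positions. Separation lets the defect
occupy at most `k - 1` positions for `t = 0`, and the occupied set loses at least one position
whenever `t` grows, until it is empty. Hence shell `k` contributes at most `(k - 1) + ... + 1 =
k.choose 2`, and the shells together at most `(r - 1) r (r + 1) / 6`.

Equality holds iff every shell `k ≥ 2` contains an apex `(1 + j, 1 - j, 1 - k)`. Separation makes `j
= jₖ` unique and forces `jₖ₊₁ ∈ {jₖ, k, -k}` (`apex_step`). With `j₁ = 0` this leaves three choices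
at each of `r - 1` steps; every such sequence occurs, and its apexes generate the whole defect. -/

/-- The complement `C \ I` of a CSSC ideal in the central one, in the coordinates `aᵢ - r`
(with `aᵢ` running from `1` to `2r`), in which `C` is `x + y + z ≤ 1` and the duality is
`x ↦ 1 - x` on every coordinate. -/
structure IsDefect (r : ℕ) (S : ℤ → ℤ → ℤ → Prop) : Prop where
  lower : ∀ {x y z}, S x y z → 1 - (r : ℤ) ≤ x
  upper : ∀ {x y z}, S x y z → x ≤ r
  sum_le : ∀ {x y z}, S x y z → x + y + z ≤ 1
  rot : ∀ {x y z}, S x y z → S y z x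
  up : ∀ {x y z x' y' z'}, S x y z → x ≤ x' → y ≤ y' → z ≤ z' → x' ≤ r → y' ≤ r → z' ≤ r →
    x' + y' + z' ≤ 1 → S x' y' z'
  sep : ∀ {x y z x' y' z'}, S x y z → S x' y' z' → x + x' ≤ 1 → y + y' ≤ 1 → z + z' ≤ 1 → False

/-! ### Counting in cyclic towers. -/

/-- Subsets of a cycle of odd length `2k - 1`, shrinking under the closure by predecessors. -/
structure IsCyclicTower (k : ℕ) (A : ℕ → Finset ℕ) : Prop where
  subset_range : ∀ t, A t ⊆ range (2 * k - 1)
  anti : ∀ t, t + 2 ≤ k → A (t + 1) ⊆ A t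
  pred : ∀ t i, t + 2 ≤ k → i + 1 ∈ A (t + 1) → i ∈ A t
  wrap : ∀ t, t + 2 ≤ k → 0 ∈ A (t + 1) → 2 * k - 2 ∈ A t
  opp : ∀ i ∈ A 0, i < k → i + (k - 1) ∉ A 0
  opp' : ∀ i ∈ A 0, k ≤ i → i - k ∉ A 0

namespace IsCyclicTower

variable {k : ℕ} {A : ℕ → Finset ℕ}

/-- By `opp` and `opp'`, `A 0` is disjoint from its translate by `k - 1` modulo `2k - 1`, so twice
its size is at most `2k - 1`. -/
theorem card_zero_le (hA : IsCyclicTower k A) (hk : 1 ≤ k) : #(A 0) ≤ k - 1 := by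
  classical
  have hlt : ∀ i ∈ A 0, i < 2 * k - 1 := fun i hi => mem_range.1 (hA.subset_range 0 hi)
  let f : ℕ → ℕ := fun i => if i < k then i + (k - 1) else i - k
  have hinj : Set.InjOn f (A 0) := by
    intro i hi j hj h
    have := hlt i hi
    have := hlt j hj
    simp only [f] at h
    split_ifs at h <;> omega
  have hdis : Disjoint (A 0) ((A 0).image f) := by
    rw [Finset.disjoint_right]
    intro a ha
    obtain ⟨i, hi, rfl⟩ := mem_image.1 ha
    simp only [f]
    split_ifs with h
    · exact hA.opp i hi h
    · exact hA.opp' i hi (not_lt.1 h)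
  have hsub : A 0 ∪ (A 0).image f ⊆ range (2 * k - 1) := by
    refine union_subset (hA.subset_range 0) ?_
    intro a ha
    obtain ⟨i, hi, rfl⟩ := mem_image.1 ha
    have := hlt i hi
    simp only [f, mem_range]
    split_ifs <;> omega
  have h := card_le_card hsub
  rw [card_union_of_disjoint hdis, card_image_of_injOn hinj, card_range] at h
  omega

theorem subset_zero (hA : IsCyclicTower k A) (t : ℕ) (ht : t + 1 ≤ k) : A t ⊆ A 0 := by
  induction t with
  | zero => exact subset_rfl
  | succ t ih => exact (hA.anti t (by omega)).trans (ih (by omega))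

/-- If the sizes agreed, `A t` would be closed under predecessors on the cycle, hence the whole
cycle, which is too large for `card_zero_le`. -/
theorem card_lt (hA : IsCyclicTower k A) (t : ℕ) (ht : t + 2 ≤ k) (hne : (A (t + 1)).Nonempty) :
    #(A (t + 1)) < #(A t) := by
  refine card_lt_card ((hA.anti t ht).ssubset_of_ne ?_)
  intro heq
  have hdown : ∀ n i, i + n ∈ A t → i ∈ A t := by
    intro n
    induction n with
    | zero => exact fun i h => h
    | succ n ih => exact fun i h => ih i (hA.pred t _ ht (heq ▸ h))
  obtain ⟨i, hi⟩ := hne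
  have h0 : 0 ∈ A t := hdown i 0 (by simpa [heq] using hi)
  have hl : 2 * k - 2 ∈ A t := hA.wrap t ht (heq ▸ h0)
  have hall : range (2 * k - 1) ⊆ A t := by
    intro i hi
    have := mem_range.1 hi
    exact hdown (2 * k - 2 - i) i (by rwa [show i + (2 * k - 2 - i) = 2 * k - 2 by omega])
  have h1 := card_le_card (hall.trans (hA.subset_zero t (by omega)))
  have h2 := hA.card_zero_le (by omega)
  rw [card_range] at h1
  omega

theorem card_le (hA : IsCyclicTower k A) (t : ℕ) (ht : t + 1 ≤ k) : #(A t) ≤ k - 1 - t := by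
  induction t with
  | zero => exact hA.card_zero_le ht
  | succ t ih =>
    have := ih (by omega)
    rcases (A (t + 1)).eq_empty_or_nonempty with h | h
    · simp [h]
    · have := hA.card_lt t (by omega) h
      omega

/-- Going back from the last level `k - 2`, strict growth adds at least one element per level, which
already meets the bound of `card_le`. -/
theorem card_eq (hA : IsCyclicTower k A) (hne : (A (k - 2)).Nonempty) (s : ℕ) (hs : s + 2 ≤ k) :
    #(A (k - 2 - s)) = s + 1 := by
  have hle := hA.card_le (k - 2 - s) (by omega)
  suffices s + 1 ≤ #(A (k - 2 - s)) by omega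
  induction s with
  | zero => exact hne.card_pos
  | succ s ih =>
    have h := ih (by omega) (hA.card_le _ (by omega))
    have h' := hA.card_lt (k - 2 - (s + 1)) (by omega)
    rw [show k - 2 - (s + 1) + 1 = k - 2 - s by omega] at h'
    have := h' (card_pos.1 (by omega))
    omega

theorem sum_card_le (hA : IsCyclicTower k A) : ∑ t ∈ range (k - 1), #(A t) ≤ k.choose 2 := by
  rw [Nat.choose_two_right, ← sum_range_id]
  rcases Nat.eq_zero_or_pos k with rfl | hk
  · simp
  obtain ⟨n, rfl⟩ : ∃ n, k = n + 1 := ⟨k - 1, by omega⟩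
  rw [sum_range_succ', ← sum_range_reflect]
  simp only [add_tsub_cancel_right, add_zero]
  refine sum_le_sum fun t ht => ?_
  have ht := mem_range.1 ht
  refine (hA.card_le _ (by omega)).trans (by omega)

theorem sum_card_eq_iff (hA : IsCyclicTower k A) (hk : 2 ≤ k) :
    ∑ t ∈ range (k - 1), #(A t) = k.choose 2 ↔ (A (k - 2)).Nonempty := by
  obtain ⟨n, rfl⟩ : ∃ n, k = n + 2 := ⟨k - 2, by omega⟩
  rw [Nat.choose_two_right, ← sum_range_id, sum_range_succ', ← sum_range_reflect]
  simp only [Nat.add_one_sub_one, add_zero]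
  have hle : ∀ t ∈ range (n + 1), #(A (n + 1 - 1 - t)) ≤ t + 1 := by
    intro t ht
    have ht := mem_range.1 ht
    refine (hA.card_le _ (by omega)).trans (by omega)
  rw [show n + 1 - 1 = n from rfl] at hle
  rw [sum_eq_sum_iff_of_le hle]
  constructor
  · intro h
    have := h 0 (by simp)
    exact card_pos.1 (this ▸ Nat.one_pos)
  · intro h t ht
    have ht := mem_range.1 ht
    exact hA.card_eq h t (by omega)

end IsCyclicTower

/-! ### Shells and rings of a defect. -/

/-- Coordinates of a representative of the `i`-th orbit of coordinate sum `1 - t` on the boundary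
of the central cube `[1 - k, k]³`. -/
def ringX (k t i : ℕ) : ℤ := min ((i : ℤ) - t) k
/-- See `ringX`. -/
def ringY (k i : ℕ) : ℤ := (k : ℤ) - i
/-- See `ringX`. -/
def ringZ (k t i : ℕ) : ℤ := 1 - t - ringX k t i - ringY k i

namespace IsDefect

variable {r : ℕ} {S : ℤ → ℤ → ℤ → Prop}

/-- Some rotation of the point lies on the face `z = 1 - k` or `x = k` of its shell; these are the
two branches of the minimum in `ringX`. -/
theorem exists_ring (hS : IsDefect r S) {x y z : ℤ} (h : S x y z) :
    ∃ k t i : ℕ, k ≤ r ∧ t + 2 ≤ k ∧ i + 1 < 2 * k ∧ S (ringX k t i) (ringY k i) (ringZ k t i) ∧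
      ((x = ringX k t i ∧ y = ringY k i ∧ z = ringZ k t i) ∨
       (y = ringX k t i ∧ z = ringY k i ∧ x = ringZ k t i) ∨
       (z = ringX k t i ∧ x = ringY k i ∧ y = ringZ k t i)) := by
  have h1 := hS.rot h
  have h2 := hS.rot h1
  have a1 := hS.lower h
  have a2 := hS.lower h1
  have a3 := hS.lower h2
  have b1 := hS.upper h
  have b2 := hS.upper h1
  have b3 := hS.upper h2
  have s := hS.sum_le h
  -- Separation of the point from its own rotation. A pair with sum at least `2` leaves a third
  -- coordinate at most `-1 - t`, whence `t + 2 ≤ k`.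
  have c : 2 ≤ x + y ∨ 2 ≤ y + z ∨ 2 ≤ z + x := by
    by_contra hc
    exact hS.sep h h1 (by omega) (by omega) (by omega)
  obtain ⟨k, hk⟩ : ∃ k : ℕ, (k : ℤ) = max (max x (max y z)) (1 - min x (min y z)) :=
    ⟨(max (max x (max y z)) (1 - min x (min y z))).toNat, by omega⟩
  obtain ⟨t, ht⟩ : ∃ t : ℕ, (t : ℤ) = 1 - (x + y + z) := ⟨(1 - (x + y + z)).toNat, by omega⟩
  have key : ∀ u v w : ℤ, S u v w → u + v + w = x + y + z → u ≤ k → v ≤ k → w ≤ k →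
      2 - k ≤ v → 1 - k ≤ u → 1 - k ≤ w → (w = 1 - k ∨ u = k) → ∃ i : ℕ, i + 1 < 2 * k ∧
      u = ringX k t i ∧ v = ringY k i ∧ w = ringZ k t i := by
    intro u v w _ h1 h2 h3 h4 h5 h6 h7 h8
    refine ⟨(k - v).toNat, ?_⟩
    simp only [ringX, ringY, ringZ]
    omega
  have hk1 : k ≤ r := by omega
  have hk2 : t + 2 ≤ k := by omega
  have hcase : (2 - (k : ℤ) ≤ y ∧ (z = 1 - k ∨ x = k)) ∨ (2 - (k : ℤ) ≤ z ∧ (x = 1 - k ∨ y = k)) ∨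
      (2 - (k : ℤ) ≤ x ∧ (y = 1 - k ∨ z = k)) := by omega
  rcases hcase with ⟨q1, q2⟩ | ⟨q1, q2⟩ | ⟨q1, q2⟩
  · obtain ⟨i, hi, e1, e2, e3⟩ := key x y z h (by omega) (by omega) (by omega) (by omega)
      (by omega) (by omega) (by omega) q2
    exact ⟨k, t, i, hk1, hk2, hi, by rwa [← e1, ← e2, ← e3], Or.inl ⟨e1, e2, e3⟩⟩
  · obtain ⟨i, hi, e1, e2, e3⟩ := key y z x h1 (by omega) (by omega) (by omega) (by omega)
      (by omega) (by omega) (by omega) q2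
    exact ⟨k, t, i, hk1, hk2, hi, by rwa [← e1, ← e2, ← e3], Or.inr (Or.inl ⟨e1, e2, e3⟩)⟩
  · obtain ⟨i, hi, e1, e2, e3⟩ := key z x y h2 (by omega) (by omega) (by omega) (by omega)
      (by omega) (by omega) (by omega) q2
    exact ⟨k, t, i, hk1, hk2, hi, by rwa [← e1, ← e2, ← e3], Or.inr (Or.inr ⟨e1, e2, e3⟩)⟩

end IsDefect

/-- Different ring indices give different orbits. -/
theorem ring_unique {k t i k' t' i' : ℕ} (ht : t + 2 ≤ k) (hi : i + 1 < 2 * k) (ht' : t' + 2 ≤ k')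
    (hi' : i' + 1 < 2 * k')
    (h : (ringX k t i = ringX k' t' i' ∧ ringY k i = ringY k' i' ∧ ringZ k t i = ringZ k' t' i') ∨
      (ringX k t i = ringY k' i' ∧ ringY k i = ringZ k' t' i' ∧ ringZ k t i = ringX k' t' i') ∨
      (ringX k t i = ringZ k' t' i' ∧ ringY k i = ringX k' t' i' ∧ ringZ k t i = ringY k' i')) :
    k = k' ∧ t = t' ∧ i = i' := by
  have ht : t = t' := by
    simp only [ringZ] at h
    omega
  subst ht
  have hk : k = k' := by
    simp only [ringZ, ringX, ringY] at h
    rcases h with h | h | h <;> omega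
  subst hk
  simp only [ringZ, ringX, ringY] at h
  rcases h with h | h | h <;> omega

open Classical in
/-- The ring positions that belong to a defect. -/
noncomputable def ringSet (S : ℤ → ℤ → ℤ → Prop) (k t : ℕ) : Finset ℕ :=
  {i ∈ range (2 * k - 1) | S (ringX k t i) (ringY k i) (ringZ k t i)}

theorem mem_ringSet {S : ℤ → ℤ → ℤ → Prop} {k t i : ℕ} :
    i ∈ ringSet S k t ↔ i + 1 < 2 * k ∧ S (ringX k t i) (ringY k i) (ringZ k t i) := by
  simp only [ringSet, mem_filter, mem_range, and_congr_left_iff]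
  omega

/-- The orbits in a defect, recorded by their ring indices. -/
noncomputable def ringIndices (S : ℤ → ℤ → ℤ → Prop) (r : ℕ) : Finset (Σ _ : ℕ, Σ _ : ℕ, ℕ) :=
  (range (r + 1)).sigma fun k => (range (k - 1)).sigma fun t => ringSet S k t

theorem mem_ringIndices {S : ℤ → ℤ → ℤ → Prop} {r k t i : ℕ} :
    (⟨k, t, i⟩ : Σ _ : ℕ, Σ _ : ℕ, ℕ) ∈ ringIndices S r ↔
      k ≤ r ∧ t + 2 ≤ k ∧ i + 1 < 2 * k ∧ S (ringX k t i) (ringY k i) (ringZ k t i) := by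
  simp only [ringIndices, mem_sigma, mem_range, mem_ringSet]
  constructor
  · rintro ⟨h1, h2, h3, h4⟩
    exact ⟨by omega, by omega, h3, h4⟩
  · rintro ⟨h1, h2, h3, h4⟩
    exact ⟨by omega, by omega, h3, h4⟩

namespace IsDefect

variable {r : ℕ} {S S' : ℤ → ℤ → ℤ → Prop}

/-- Raising one coordinate by one passes from ring `t + 1` to ring `t`, keeping the position or
moving to its predecessor. Opposite positions are excluded by separating one point from a rotation
of the other. -/
theorem isCyclicTower (hS : IsDefect r S) {k : ℕ} (hk : k ≤ r) :
    IsCyclicTower k (ringSet S k) where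
  subset_range t i hi := by
    rw [mem_ringSet] at hi
    rw [mem_range]
    omega
  anti t ht i hi := by
    rw [mem_ringSet] at hi ⊢
    refine ⟨hi.1, hS.up hi.2 ?_ ?_ ?_ ?_ ?_ ?_ ?_⟩ <;> simp only [ringX, ringY, ringZ] <;> omega
  pred t i ht hi := by
    rw [mem_ringSet] at hi ⊢
    refine ⟨by omega, hS.up hi.2 ?_ ?_ ?_ ?_ ?_ ?_ ?_⟩ <;>
      simp only [ringX, ringY, ringZ] <;> omega
  -- The cycle closes only up to rotation: `(-t - 1, k, 1 - k)` is rotated to `(k, 1 - k, -t - 1)`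
  -- before its second coordinate is raised.
  wrap t ht hi := by
    rw [mem_ringSet] at hi ⊢
    have e1 : ringX k (t + 1) 0 = -t - 1 := by simp only [ringX]; push_cast; omega
    have e2 : ringX k t (2 * k - 2) = k := by
      simp only [ringX]
      rw [Nat.cast_sub (by omega)]
      push_cast
      omega
    refine ⟨by omega, hS.up (hS.rot hi.2) ?_ ?_ ?_ ?_ ?_ ?_ ?_⟩ <;>
      simp only [ringZ, e1, e2, ringY] <;> omega
  opp i hi hik hi' := by
    rw [mem_ringSet] at hi hi'
    refine hS.sep hi.2 (hS.rot hi'.2) ?_ ?_ ?_ <;> simp only [ringX, ringY, ringZ] <;> omega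
  opp' i hi hik hi' := by
    rw [mem_ringSet] at hi hi'
    refine hS.sep hi'.2 (hS.rot hi.2) ?_ ?_ ?_ <;> simp only [ringX, ringY, ringZ] <;> omega

theorem card_ringIndices_le (hS : IsDefect r S) :
    #(ringIndices S r) ≤ ∑ k ∈ range (r + 1), k.choose 2 := by
  simp only [ringIndices, card_sigma]
  refine sum_le_sum fun k hk => ?_
  exact (hS.isCyclicTower (Nat.lt_succ_iff.1 (mem_range.1 hk))).sum_card_le

theorem card_ringIndices_eq_iff (hS : IsDefect r S) :
    #(ringIndices S r) = ∑ k ∈ range (r + 1), k.choose 2 ↔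
      ∀ k : ℕ, 2 ≤ k → k ≤ r → ∃ j : ℤ, 1 - (k : ℤ) ≤ j ∧ j ≤ (k : ℤ) - 1 ∧
        S (1 + j) (1 - j) (1 - k) := by
  simp only [ringIndices, card_sigma]
  rw [sum_eq_sum_iff_of_le
    fun k hk => (hS.isCyclicTower (Nat.lt_succ_iff.1 (mem_range.1 hk))).sum_card_le]
  constructor
  · intro h k hk hkr
    have := h k (by simp; omega)
    obtain ⟨i, hi⟩ := ((hS.isCyclicTower hkr).sum_card_eq_iff hk).1 this
    rw [mem_ringSet] at hi
    refine ⟨(i : ℤ) + 1 - k, by omega, by omega, ?_⟩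
    convert hi.2 using 1 <;> simp only [ringX, ringY, ringZ] <;> omega
  · intro h k hk
    have hkr : k ≤ r := Nat.lt_succ_iff.1 (mem_range.1 hk)
    rcases Nat.lt_or_ge k 2 with hk2 | hk2
    · rw [Nat.choose_eq_zero_of_lt hk2, show k - 1 = 0 by omega]
      simp
    · obtain ⟨j, h1, h2, h3⟩ := h k hk2 hkr
      refine ((hS.isCyclicTower hkr).sum_card_eq_iff hk2).2 ⟨(j + k - 1).toNat, ?_⟩
      rw [mem_ringSet]
      refine ⟨by omega, ?_⟩
      convert h3 using 1 <;> simp only [ringX, ringY, ringZ] <;> omega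

theorem ringIndices_mono (h : ∀ x y z, S x y z → S' x y z) :
    ringIndices S r ⊆ ringIndices S' r := by
  rintro ⟨k, t, i⟩ hi
  rw [mem_ringIndices] at hi ⊢
  exact ⟨hi.1, hi.2.1, hi.2.2.1, h _ _ _ hi.2.2.2⟩

theorem of_ringIndices_subset (hS : IsDefect r S) (hS' : IsDefect r S')
    (h : ringIndices S r ⊆ ringIndices S' r) {x y z : ℤ} (hx : S x y z) : S' x y z := by
  obtain ⟨k, t, i, h1, h2, h3, h4, h5⟩ := hS.exists_ring hx
  have := (mem_ringIndices.1 (h (mem_ringIndices.2 ⟨h1, h2, h3, h4⟩))).2.2.2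
  rcases h5 with ⟨rfl, rfl, rfl⟩ | ⟨rfl, rfl, rfl⟩ | ⟨rfl, rfl, rfl⟩
  · exact this
  · exact hS'.rot (hS'.rot this)
  · exact hS'.rot this

end IsDefect

/-! ### Extremal defects built from ternary choices. -/

/-- The sequence determined by choosing at each step whether to stay or to jump to one of the two
extreme values. -/
def apexSeq (c : ℕ → Fin 3) : ℕ → ℤ
  | 0 => 0
  | k + 1 => if c k = 0 then apexSeq c k else if c k = 1 then (k : ℤ) else -(k : ℤ)

theorem apexSeq_bound (c : ℕ → Fin 3) (k : ℕ) :
    1 - (k + 1 : ℕ) ≤ apexSeq c (k + 1) ∧ apexSeq c (k + 1) ≤ (k + 1 : ℕ) - (1 : ℤ) := by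
  induction k with
  | zero => simp [apexSeq]
  | succ k ih =>
    rw [apexSeq]
    split_ifs <;> omega

/-- Any jump at or after index `l` lands at absolute value at least `l`. This is what separates the
apexes of different shells. -/
theorem apexSeq_compat (c : ℕ → Fin 3) {l k : ℕ} (h : l ≤ k) :
    apexSeq c k = apexSeq c l ∨ (l : ℤ) ≤ apexSeq c k ∨ apexSeq c k ≤ -(l : ℤ) := by
  induction k, h using Nat.le_induction with
  | base => exact Or.inl rfl
  | succ k h ih =>
    rw [apexSeq]
    split_ifs <;> omega

/-- The upper set generated in the shells of index at least two by the points
`(1 + jₖ, 1 - jₖ, 1 - k)` and their rotations. -/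
def apexDefect (r : ℕ) (j : ℕ → ℤ) (x y z : ℤ) : Prop :=
  x ≤ r ∧ y ≤ r ∧ z ≤ r ∧ x + y + z ≤ 1 ∧ ∃ k : ℕ, 2 ≤ k ∧ k ≤ r ∧
    ((1 + j k ≤ x ∧ 1 - j k ≤ y ∧ 1 - (k : ℤ) ≤ z) ∨
     (1 + j k ≤ y ∧ 1 - j k ≤ z ∧ 1 - (k : ℤ) ≤ x) ∨
     (1 + j k ≤ z ∧ 1 - j k ≤ x ∧ 1 - (k : ℤ) ≤ y))

theorem isDefect_apexDefect (r : ℕ) (c : ℕ → Fin 3) : IsDefect r (apexDefect r (apexSeq c)) where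
  lower := by
    rintro x y z ⟨h1, h2, h3, h4, k, hk, hkr, h⟩
    have := apexSeq_bound c (k - 1)
    rw [show k - 1 + 1 = k by omega] at this
    omega
  upper h := h.1
  sum_le h := h.2.2.2.1
  rot := by
    rintro x y z ⟨h1, h2, h3, h4, k, hk, hkr, h⟩
    exact ⟨h2, h3, h1, by omega, k, hk, hkr, by tauto⟩
  up := by
    rintro x y z x' y' z' ⟨h1, h2, h3, h4, k, hk, hkr, h⟩ hx hy hz hx' hy' hz' hs
    exact ⟨hx', hy', hz', hs, k, hk, hkr, by omega⟩
  sep := by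
    have key : ∀ {k l : ℕ}, l ≤ k → 2 ≤ l → ∀ {x y z x' y' z' : ℤ},
        ((1 + apexSeq c k ≤ x ∧ 1 - apexSeq c k ≤ y ∧ 1 - (k : ℤ) ≤ z) ∨
         (1 + apexSeq c k ≤ y ∧ 1 - apexSeq c k ≤ z ∧ 1 - (k : ℤ) ≤ x) ∨
         (1 + apexSeq c k ≤ z ∧ 1 - apexSeq c k ≤ x ∧ 1 - (k : ℤ) ≤ y)) →
        ((1 + apexSeq c l ≤ x' ∧ 1 - apexSeq c l ≤ y' ∧ 1 - (l : ℤ) ≤ z') ∨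
         (1 + apexSeq c l ≤ y' ∧ 1 - apexSeq c l ≤ z' ∧ 1 - (l : ℤ) ≤ x') ∨
         (1 + apexSeq c l ≤ z' ∧ 1 - apexSeq c l ≤ x' ∧ 1 - (l : ℤ) ≤ y')) →
        x + x' ≤ 1 → y + y' ≤ 1 → z + z' ≤ 1 → False := by
      intro k l hlk hl x y z x' y' z' h h' _ _ _
      have b1 := apexSeq_bound c (l - 1)
      rw [show l - 1 + 1 = l by omega] at b1
      have b3 := apexSeq_compat c hlk
      generalize apexSeq c k = a at *
      generalize apexSeq c l = b at *
      rcases h with h | h | h <;> rcases h' with h' | h' | h' <;> omega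
    rintro x y z x' y' z' ⟨-, -, -, -, k, hk, -, h⟩ ⟨-, -, -, -, l, hl, -, h'⟩ e1 e2 e3
    rcases le_total l k with hlk | hlk
    · exact key hlk hl h h' e1 e2 e3
    · exact key hlk hk h' h (by omega) (by omega) (by omega)

theorem apexDefect_apex {r k : ℕ} (c : ℕ → Fin 3) (hk : 2 ≤ k) (hkr : k ≤ r) :
    apexDefect r (apexSeq c) (1 + apexSeq c k) (1 - apexSeq c k) (1 - k) := by
  have := apexSeq_bound c (k - 1)
  rw [show k - 1 + 1 = k by omega] at this
  exact ⟨by omega, by omega, by omega, by omega, k, hk, hkr, Or.inl ⟨by omega, by omega, by omega⟩⟩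

theorem card_ringIndices_apexDefect (r : ℕ) (c : ℕ → Fin 3) :
    #(ringIndices (apexDefect r (apexSeq c)) r) = ∑ k ∈ range (r + 1), k.choose 2 := by
  refine (isDefect_apexDefect r c).card_ringIndices_eq_iff.2 fun k hk hkr => ?_
  have := apexSeq_bound c (k - 1)
  rw [show k - 1 + 1 = k by omega] at this
  exact ⟨apexSeq c k, this.1, this.2, apexDefect_apex c hk hkr⟩

/-- The choices made by a sequence. -/
def choiceOf (j : ℕ → ℤ) (k : ℕ) : Fin 3 :=
  if j (k + 1) = j k then 0 else if j (k + 1) = k then 1 else 2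

theorem apexSeq_choiceOf {r : ℕ} {j : ℕ → ℤ} (h0 : j 0 = 0) (h1 : j 1 = 0)
    (h : ∀ k, 1 ≤ k → k + 1 ≤ r → j (k + 1) = j k ∨ j (k + 1) = k ∨ j (k + 1) = -k)
    {k : ℕ} (hk : k ≤ r) : apexSeq (choiceOf j) k = j k := by
  induction k with
  | zero => simp [apexSeq, h0]
  | succ k ih =>
    rw [apexSeq, ih (by omega), choiceOf]
    rcases Nat.eq_zero_or_pos k with rfl | hpos
    · simp [h0, h1]
    · have := h k hpos hk
      split_ifs <;> simp_all

/-! ### Rigidity of defects of maximal size. -/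

namespace IsDefect

variable {r : ℕ} {S : ℤ → ℤ → ℤ → Prop}

theorem apex_unique (hS : IsDefect r S) {k : ℕ} {j j' : ℤ} (hj : 1 - (k : ℤ) ≤ j)
    (hj₂ : j ≤ (k : ℤ) - 1) (hj' : 1 - (k : ℤ) ≤ j') (hj₂' : j' ≤ (k : ℤ) - 1)
    (h : S (1 + j) (1 - j) (1 - k)) (h' : S (1 + j') (1 - j') (1 - k)) : j = j' := by
  rcases lt_trichotomy j j' with hlt | heq | hlt
  · exact (hS.sep h (hS.rot h') (by omega) (by omega) (by omega)).elim
  · exact heq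
  · exact (hS.sep h' (hS.rot h) (by omega) (by omega) (by omega)).elim

/-- For any other `j`, the new apex violates separation against a rotation of the old one: one
rotation if `j < i`, two if `j > i`. -/
theorem apex_step (hS : IsDefect r S) {k : ℕ} {i j : ℤ} (hi : 1 - (k : ℤ) ≤ i)
    (hi₂ : i ≤ (k : ℤ) - 1) (hj : -(k : ℤ) ≤ j) (hj₂ : j ≤ k) (h : S (1 + i) (1 - i) (1 - k))
    (h' : S (1 + j) (1 - j) (1 - (k + 1 : ℕ))) : j = i ∨ j = k ∨ j = -k := by
  by_contra hne
  rcases lt_or_gt_of_ne (show j ≠ i by omega) with hlt | hlt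
  · exact hS.sep h' (hS.rot h) (by omega) (by omega) (by omega)
  · exact hS.sep h' (hS.rot (hS.rot h)) (by omega) (by omega) (by omega)

theorem exists_eq_apexDefect (hS : IsDefect r S)
    (hcard : #(ringIndices S r) = ∑ k ∈ range (r + 1), k.choose 2) :
    ∃ c : ℕ → Fin 3, S = apexDefect r (apexSeq c) := by
  have h := hS.card_ringIndices_eq_iff.1 hcard
  choose! j hj1 hj2 hj3 using h
  -- Apexes exist only from shell `2` on; the value `0` below agrees with `apexSeq`, which vanishes
  -- at `0` and `1` for every choice.
  let j' : ℕ → ℤ := fun k => if k < 2 then 0 else j k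
  have hj' : ∀ k, 2 ≤ k → j' k = j k := fun k hk => if_neg (by omega)
  have hseq : ∀ k, k ≤ r → apexSeq (choiceOf j') k = j' k := by
    intro k hk
    refine apexSeq_choiceOf (by simp [j']) (by simp [j']) ?_ hk
    intro k h1 hkr
    rw [hj' (k + 1) (by omega)]
    have a1 := hj1 (k + 1) (by omega) hkr
    have a2 := hj2 (k + 1) (by omega) hkr
    rcases Nat.lt_or_ge k 2 with hk2 | hk2
    · obtain rfl : k = 1 := by omega
      simp only [j']
      norm_num at *
      omega
    · rw [hj' k hk2]
      exact hS.apex_step (hj1 k hk2 (by omega)) (hj2 k hk2 (by omega)) (by omega) (by omega)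
        (hj3 k hk2 (by omega)) (hj3 (k + 1) (by omega) hkr)
  refine ⟨choiceOf j', ?_⟩
  have hT := isDefect_apexDefect r (choiceOf j')
  have hsub : ∀ x y z, apexDefect r (apexSeq (choiceOf j')) x y z → S x y z := by
    rintro x y z ⟨h1, h2, h3, h4, k, hk, hkr, h⟩
    rw [hseq k hkr, hj' k hk] at h
    have hap := hj3 k hk hkr
    rcases h with ⟨e1, e2, e3⟩ | ⟨e1, e2, e3⟩ | ⟨e1, e2, e3⟩
    · exact hS.up hap e1 e2 e3 h1 h2 h3 h4
    · exact hS.up (hS.rot (hS.rot hap)) e3 e1 e2 h1 h2 h3 h4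
    · exact hS.up (hS.rot hap) e2 e3 e1 h1 h2 h3 h4
  -- The defect generated by the apexes already has maximal size, so its inclusion in `S` is an
  -- equality.
  have heq : ringIndices (apexDefect r (apexSeq (choiceOf j'))) r = ringIndices S r :=
    eq_of_subset_of_card_le (ringIndices_mono hsub)
      (by rw [hcard, card_ringIndices_apexDefect])
  funext x y z
  exact propext ⟨fun hx => hS.of_ringIndices_subset hT heq.ge hx, hsub x y z⟩

end IsDefect

theorem apexSeq_eq_of_apexDefect_eq {r k : ℕ} {c c' : ℕ → Fin 3}
    (h : apexDefect r (apexSeq c) = apexDefect r (apexSeq c')) (hk : 2 ≤ k) (hkr : k ≤ r) :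
    apexSeq c k = apexSeq c' k := by
  have b := apexSeq_bound c (k - 1)
  have b' := apexSeq_bound c' (k - 1)
  rw [show k - 1 + 1 = k by omega] at b b'
  exact (isDefect_apexDefect r c).apex_unique b.1 b.2 b'.1 b'.2 (apexDefect_apex c hk hkr)
    (h ▸ apexDefect_apex c' hk hkr)

/-- The choice can be read off because `jₖ`, `k` and `-k` are distinct: `|jₖ| < k` for `k ≥ 1`. -/
theorem choice_eq_of_apexDefect_eq {r k : ℕ} {c c' : ℕ → Fin 3}
    (h : apexDefect r (apexSeq c) = apexDefect r (apexSeq c')) (hk : 1 ≤ k) (hkr : k + 1 ≤ r) :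
    c k = c' k := by
  have h1 := apexSeq_eq_of_apexDefect_eq h (show 2 ≤ k + 1 by omega) hkr
  have h0 : apexSeq c k = apexSeq c' k := by
    rcases Nat.lt_or_ge k 2 with hk2 | hk2
    · obtain rfl : k = 1 := by omega
      simp [apexSeq]
    · exact apexSeq_eq_of_apexDefect_eq h hk2 (by omega)
  have b := apexSeq_bound c (k - 1)
  rw [show k - 1 + 1 = k by omega] at b
  have tri : ∀ a : Fin 3, a = 0 ∨ a = 1 ∨ a = 2 := by decide
  rw [apexSeq, apexSeq, ← h0] at h1
  rcases tri (c k) with e | e | e <;> rcases tri (c' k) with e' | e' | e' <;>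
    rw [e, e'] at h1 ⊢ <;> simp at h1 <;> omega

theorem apexDefect_congr {r : ℕ} {c c' : ℕ → Fin 3} (h : ∀ k, 1 ≤ k → k + 1 ≤ r → c k = c' k) :
    apexDefect r (apexSeq c) = apexDefect r (apexSeq c') := by
  have hs : ∀ k, k ≤ r → apexSeq c k = apexSeq c' k := by
    intro k hk
    induction k with
    | zero => rfl
    | succ k ih =>
      rcases Nat.eq_zero_or_pos k with rfl | hpos
      · simp [apexSeq]
      · rw [apexSeq, apexSeq, h k hpos hk, ih (by omega)]
  funext x y z
  simp only [apexDefect]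
  refine propext <| and_congr_right fun _ => and_congr_right fun _ => and_congr_right fun _ =>
    and_congr_right fun _ => exists_congr fun k => and_congr_right fun _ => and_congr_right ?_
  intro hkr
  rw [hs k hkr]

/-! ### Dictionary between CSSC ideals and defects. -/

namespace CSSCIdeal

variable {r : ℕ}

/-- The points of the central ideal missing from `I`, in coordinates shifted by `r`. -/
def defect (I : CSSCIdeal r) (x y z : ℤ) : Prop :=
  x + y + z ≤ 1 ∧ ∃ a : Cube r, a ∉ I.ideal ∧
    (a.1 : ℤ) + 1 - r = x ∧ (a.2.1 : ℤ) + 1 - r = y ∧ (a.2.2 : ℤ) + 1 - r = z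

theorem defect_coe (I : CSSCIdeal r) (a : Cube r) :
    I.defect ((a.1 : ℤ) + 1 - r) ((a.2.1 : ℤ) + 1 - r) ((a.2.2 : ℤ) + 1 - r) ↔
      (a.1 : ℤ) + a.2.1 + a.2.2 + 2 ≤ 3 * r ∧ a ∉ I.ideal := by
  constructor
  · rintro ⟨hs, b, hb, h1, h2, h3⟩
    have : b = a := by
      ext <;> omega
    subst this
    exact ⟨by omega, hb⟩
  · rintro ⟨hs, ha⟩
    exact ⟨by omega, a, ha, rfl, rfl, rfl⟩

theorem not_mem_of_rot_not_mem (I : CSSCIdeal r) {a : Cube r} (h : a ∉ I.ideal) :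
    a.rot ∉ I.ideal := fun h' => h (I.cyclicallySymmetric _ h').2

theorem exists_cube {x y z : ℤ} (hx : 1 - (r : ℤ) ≤ x) (hx' : x ≤ r) (hy : 1 - (r : ℤ) ≤ y)
    (hy' : y ≤ r) (hz : 1 - (r : ℤ) ≤ z) (hz' : z ≤ r) :
    ∃ a : Cube r, (a.1 : ℤ) + 1 - r = x ∧ (a.2.1 : ℤ) + 1 - r = y ∧ (a.2.2 : ℤ) + 1 - r = z := by
  refine ⟨(⟨(x + r - 1).toNat, by omega⟩, ⟨(y + r - 1).toNat, by omega⟩,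
    ⟨(z + r - 1).toNat, by omega⟩), ?_, ?_, ?_⟩ <;> dsimp only <;> omega

theorem dual_coords (a : Cube r) : ((a.dual.1 : ℕ) : ℤ) + 1 - r = 1 - ((a.1 : ℤ) + 1 - r) ∧
    ((a.dual.2.1 : ℕ) : ℤ) + 1 - r = 1 - ((a.2.1 : ℤ) + 1 - r) ∧
    ((a.dual.2.2 : ℕ) : ℤ) + 1 - r = 1 - ((a.2.2 : ℤ) + 1 - r) := by
  simp only [Cube.dual, Fin.val_rev]
  omega

theorem isDefect_defect (I : CSSCIdeal r) : IsDefect r I.defect where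
  lower := by
    rintro x y z ⟨-, a, -, h1, -, -⟩
    omega
  upper := by
    rintro x y z ⟨-, a, -, h1, -, -⟩
    omega
  sum_le h := h.1
  rot := by
    rintro x y z ⟨hs, a, ha, h1, h2, h3⟩
    exact ⟨by omega, a.rot, I.not_mem_of_rot_not_mem ha, h2, h3, h1⟩
  up := by
    rintro x y z x' y' z' ⟨-, a, ha, h1, h2, h3⟩ hx hy hz hx' hy' hz' hs
    obtain ⟨b, e1, e2, e3⟩ := exists_cube (r := r) (x := x') (y := y') (z := z') (by omega) hx'
      (by omega) hy' (by omega) hz'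
    refine ⟨hs, b, fun hb => ha (I.ideal.lower ?_ hb), e1, e2, e3⟩
    refine ⟨?_, ?_, ?_⟩ <;> rw [Fin.le_def] <;> omega
  sep := by
    rintro x y z x' y' z' ⟨-, a, ha, h1, h2, h3⟩ ⟨-, b, hb, e1, e2, e3⟩ hx hy hz
    have hb' : b.dual ∈ I.ideal := by
      by_contra h
      exact hb ((I.selfComplementary b).2 h)
    have := dual_coords b
    refine ha (I.ideal.lower ?_ hb')
    refine ⟨?_, ?_, ?_⟩ <;> rw [Fin.le_def] <;> omega

theorem mem_iff_defect (I : CSSCIdeal r) (a : Cube r) : a ∈ I.ideal ↔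
    ((a.1 : ℤ) + a.2.1 + a.2.2 + 2 ≤ 3 * r ∧
      ¬ I.defect ((a.1 : ℤ) + 1 - r) ((a.2.1 : ℤ) + 1 - r) ((a.2.2 : ℤ) + 1 - r)) ∨
    (3 * r < (a.1 : ℤ) + a.2.1 + a.2.2 + 2 ∧
      I.defect (1 - ((a.1 : ℤ) + 1 - r)) (1 - ((a.2.1 : ℤ) + 1 - r))
        (1 - ((a.2.2 : ℤ) + 1 - r))) := by
  obtain ⟨d1, d2, d3⟩ := dual_coords a
  rw [← d1, ← d2, ← d3, defect_coe, defect_coe, I.selfComplementary a, I.selfComplementary a.dual,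
    Cube.dual_dual]
  by_cases ha : a ∈ I.ideal
  · simp only [ha]
    simp
    omega
  · simp [ha]

theorem defect_injective : Function.Injective (defect (r := r)) := by
  intro I J h
  have : I.ideal = J.ideal := by
    ext a
    change a ∈ I.ideal ↔ a ∈ J.ideal
    rw [mem_iff_defect, mem_iff_defect, h]
  cases I
  cases J
  simpa using this

/-- The CSSC ideal with a given defect. -/
def ofDefect {S : ℤ → ℤ → ℤ → Prop} (hS : IsDefect r S) : CSSCIdeal r where
  ideal :=
    { carrier := {a |
        ((a.1 : ℤ) + a.2.1 + a.2.2 + 2 ≤ 3 * r ∧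
          ¬ S ((a.1 : ℤ) + 1 - r) ((a.2.1 : ℤ) + 1 - r) ((a.2.2 : ℤ) + 1 - r)) ∨
        (3 * r < (a.1 : ℤ) + a.2.1 + a.2.2 + 2 ∧
          S (1 - ((a.1 : ℤ) + 1 - r)) (1 - ((a.2.1 : ℤ) + 1 - r)) (1 - ((a.2.2 : ℤ) + 1 - r)))}
      lower' := by
        rintro a b ⟨h1, h2, h3⟩ ha
        rw [Fin.le_def] at h1 h2 h3
        simp only [Set.mem_ofPred_eq] at ha ⊢
        rcases ha with ⟨hs, ha⟩ | ⟨hs, ha⟩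
        · refine Or.inl ⟨by omega, fun hb => ha (hS.up hb ?_ ?_ ?_ ?_ ?_ ?_ ?_)⟩ <;> omega
        -- Going down from the upper half may cross the middle; there separation replaces upward
        -- closure.
        · by_cases hb : (b.1 : ℤ) + b.2.1 + b.2.2 + 2 ≤ 3 * r
          · exact Or.inl ⟨hb, fun hb' => hS.sep hb' ha (by omega) (by omega) (by omega)⟩
          · refine Or.inr ⟨by omega, hS.up ha ?_ ?_ ?_ ?_ ?_ ?_ ?_⟩ <;> omega }
  selfComplementary := by
    intro a
    obtain ⟨d1, d2, d3⟩ := dual_coords a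
    change (_ ∨ _) ↔ ¬ (_ ∨ _)
    rw [d1, d2, d3]
    simp only [sub_sub_cancel]
    by_cases h : (a.1 : ℤ) + a.2.1 + a.2.2 + 2 ≤ 3 * r
    · have h' : 3 * (r : ℤ) < (a.dual.1 : ℤ) + a.dual.2.1 + a.dual.2.2 + 2 := by omega
      simp [h, h'.not_ge, h', h.not_gt]
    · have h' : (a.dual.1 : ℤ) + a.dual.2.1 + a.dual.2.2 + 2 ≤ 3 * r := by omega
      simp [h, h', h'.not_gt, lt_of_not_ge h]
  cyclicallySymmetric := by
    have key : ∀ a : Cube r,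
        (((a.1 : ℤ) + a.2.1 + a.2.2 + 2 ≤ 3 * r ∧
          ¬ S ((a.1 : ℤ) + 1 - r) ((a.2.1 : ℤ) + 1 - r) ((a.2.2 : ℤ) + 1 - r)) ∨
        (3 * r < (a.1 : ℤ) + a.2.1 + a.2.2 + 2 ∧
          S (1 - ((a.1 : ℤ) + 1 - r)) (1 - ((a.2.1 : ℤ) + 1 - r)) (1 - ((a.2.2 : ℤ) + 1 - r)))) →
        (((a.2.1 : ℤ) + a.2.2 + a.1 + 2 ≤ 3 * r ∧
          ¬ S ((a.2.1 : ℤ) + 1 - r) ((a.2.2 : ℤ) + 1 - r) ((a.1 : ℤ) + 1 - r)) ∨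
        (3 * r < (a.2.1 : ℤ) + a.2.2 + a.1 + 2 ∧
          S (1 - ((a.2.1 : ℤ) + 1 - r)) (1 - ((a.2.2 : ℤ) + 1 - r))
            (1 - ((a.1 : ℤ) + 1 - r)))) := by
      rintro a (⟨hs, ha⟩ | ⟨hs, ha⟩)
      · exact Or.inl ⟨by omega, fun h => ha (hS.rot (hS.rot h))⟩
      · exact Or.inr ⟨by omega, hS.rot ha⟩
    intro a ha
    exact ⟨key a ha, key a.rot (key a ha)⟩

theorem defect_ofDefect {S : ℤ → ℤ → ℤ → Prop} (hS : IsDefect r S) : (ofDefect hS).defect = S := by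
  have key : ∀ a : Cube r, (a.1 : ℤ) + a.2.1 + a.2.2 + 2 ≤ 3 * r → (a ∉ (ofDefect hS).ideal ↔
      S ((a.1 : ℤ) + 1 - r) ((a.2.1 : ℤ) + 1 - r) ((a.2.2 : ℤ) + 1 - r)) := by
    intro a hs
    change ¬ (_ ∨ _) ↔ _
    simp [hs, hs.not_gt]
  funext x y z
  refine propext ⟨?_, fun h => ?_⟩
  · rintro ⟨hs, a, ha, rfl, rfl, rfl⟩
    exact (key a (by omega)).1 ha
  · have h' := hS.rot h
    have h'' := hS.rot h'
    have hs := hS.sum_le h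
    obtain ⟨a, rfl, rfl, rfl⟩ := exists_cube (hS.lower h) (hS.upper h) (hS.lower h') (hS.upper h')
      (hS.lower h'') (hS.upper h'')
    exact ⟨hs, a, (key a (by omega)).2 h, rfl, rfl, rfl⟩

theorem defect_center (x y z : ℤ) : ¬ (center r).defect x y z := by
  rintro ⟨hs, a, ha, rfl, rfl, rfl⟩
  refine ha ?_
  change (a.1 : ℕ) + 1 + (a.2.1 + 1) + (a.2.2 + 1) ≤ 3 * r + 1
  omega

/-! ### Distance from the center. -/

/-- The number of orbits in which `I` differs from the central ideal. -/
noncomputable def defectCard (I : CSSCIdeal r) : ℕ := #(ringIndices I.defect r)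

theorem defectCard_center : defectCard (center r) = 0 := by
  rw [defectCard, card_eq_zero, eq_empty_iff_forall_notMem]
  rintro ⟨k, t, i⟩ h
  exact defect_center _ _ _ (mem_ringIndices.1 h).2.2.2

/-- A point entering the defect has left the ideal, so it lies in the orbit of the flipped point
`a`; by `ring_unique` one orbit carries at most one ring index. -/
theorem defectCard_le_add_one {I J : CSSCIdeal r} (h : (flipGraph r).Adj I J) :
    J.defectCard ≤ I.defectCard + 1 := by
  obtain ⟨-, a, ha, hJ⟩ := h
  have key : ∀ x y z, J.defect x y z → ¬ I.defect x y z →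
      (x = (a.1 : ℤ) + 1 - r ∧ y = (a.2.1 : ℤ) + 1 - r ∧ z = (a.2.2 : ℤ) + 1 - r) ∨
      (x = (a.2.1 : ℤ) + 1 - r ∧ y = (a.2.2 : ℤ) + 1 - r ∧ z = (a.1 : ℤ) + 1 - r) ∨
      (x = (a.2.2 : ℤ) + 1 - r ∧ y = (a.1 : ℤ) + 1 - r ∧ z = (a.2.1 : ℤ) + 1 - r) := by
    rintro x y z ⟨hs, b, hb, rfl, rfl, rfl⟩ hI
    have hbI : b ∈ I.ideal := by
      by_contra hbI
      exact hI ⟨hs, b, hbI, rfl, rfl, rfl⟩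
    have hbo : b ∈ a.orbit := by
      by_contra hbo
      exact hb (show b ∈ (J.ideal : Set (Cube r)) from hJ ▸ Or.inl ⟨hbI, hbo⟩)
    rcases hbo with rfl | rfl | rfl
    · exact Or.inl ⟨rfl, rfl, rfl⟩
    · exact Or.inr (Or.inl ⟨rfl, rfl, rfl⟩)
    · exact Or.inr (Or.inr ⟨rfl, rfl, rfl⟩)
  have hone : #(ringIndices J.defect r \ ringIndices I.defect r) ≤ 1 := by
    rw [card_le_one]
    rintro ⟨k, t, i⟩ h ⟨k', t', i'⟩ h'
    rw [mem_sdiff, mem_ringIndices, mem_ringIndices] at h h'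
    obtain ⟨⟨h1, h2, h3, h4⟩, h5⟩ := h
    obtain ⟨⟨h1', h2', h3', h4'⟩, h5'⟩ := h'
    have e := key _ _ _ h4 fun hI => h5 ⟨h1, h2, h3, hI⟩
    have e' := key _ _ _ h4' fun hI => h5' ⟨h1', h2', h3', hI⟩
    obtain ⟨rfl, rfl, rfl⟩ := ring_unique h2 h3 h2' h3' (by
      rcases e with ⟨e1, e2, e3⟩ | ⟨e1, e2, e3⟩ | ⟨e1, e2, e3⟩ <;>
      rcases e' with ⟨e1', e2', e3'⟩ | ⟨e1', e2', e3'⟩ | ⟨e1', e2', e3'⟩ <;>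
      simp only [e1, e2, e3, e1', e2', e3', and_self, true_or, or_true])
    rfl
  have h1 := card_le_card_sdiff_add_card (s := ringIndices J.defect r) (t := ringIndices I.defect r)
  unfold defectCard
  omega

theorem defectCard_le_length {I J : CSSCIdeal r} (p : (flipGraph r).Walk I J) :
    J.defectCard ≤ I.defectCard + p.length := by
  induction p with
  | nil => simp
  | cons h p ih =>
    have := defectCard_le_add_one h
    rw [SimpleGraph.Walk.length_cons]
    omega

end CSSCIdeal

/-- A defect stays a defect when the orbit of an element of least coordinate sum is removed. -/
theorem IsDefect.remove {r : ℕ} {S : ℤ → ℤ → ℤ → Prop} (hS : IsDefect r S) {u v w : ℤ}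
    (hmin : ∀ x y z, S x y z → u + v + w ≤ x + y + z) :
    IsDefect r fun x y z => S x y z ∧ ¬ ((x = u ∧ y = v ∧ z = w) ∨ (x = v ∧ y = w ∧ z = u) ∨
      (x = w ∧ y = u ∧ z = v)) where
  lower h := hS.lower h.1
  upper h := hS.upper h.1
  sum_le h := hS.sum_le h.1
  rot h := ⟨hS.rot h.1, fun h' => h.2 (by tauto)⟩
  up := by
    rintro x y z x' y' z' ⟨h, h'⟩ hx hy hz hx' hy' hz' hs
    refine ⟨hS.up h hx hy hz hx' hy' hz' hs, fun e => h' ?_⟩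
    have := hmin _ _ _ h
    omega
  sep h h' := hS.sep h.1 h'.1

namespace CSSCIdeal

variable {r : ℕ}

theorem exists_adj_defectCard_lt {I : CSSCIdeal r} (hI : I ≠ center r) :
    ∃ J : CSSCIdeal r, (flipGraph r).Adj J I ∧ J.defectCard < I.defectCard := by
  have hS := I.isDefect_defect
  obtain ⟨x₀, y₀, z₀, h₀⟩ : ∃ x y z, I.defect x y z := by
    by_contra! h
    refine hI (defect_injective ?_)
    funext x y z
    exact propext ⟨fun h' => (h x y z h').elim, fun h' => (defect_center x y z h').elim⟩
  -- Adding `3 * r` makes the coordinate sums natural numbers, so that a least one exists.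
  have hne : {n : ℕ | ∃ x y z, I.defect x y z ∧ (n : ℤ) = x + y + z + 3 * r}.Nonempty := by
    have a1 := hS.lower h₀
    have a2 := hS.lower (hS.rot h₀)
    have a3 := hS.lower (hS.rot (hS.rot h₀))
    exact ⟨(x₀ + y₀ + z₀ + 3 * r).toNat, x₀, y₀, z₀, h₀, by omega⟩
  obtain ⟨u, v, w, huvw, hsum⟩ := Nat.sInf_mem hne
  have hmin : ∀ x y z, I.defect x y z → u + v + w ≤ x + y + z := by
    intro x y z h
    have a1 := hS.lower h
    have a2 := hS.lower (hS.rot h)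
    have a3 := hS.lower (hS.rot (hS.rot h))
    have : sInf {n : ℕ | ∃ x y z, I.defect x y z ∧ (n : ℤ) = x + y + z + 3 * r} ≤
        (x + y + z + 3 * r).toNat := Nat.sInf_le ⟨x, y, z, h, by omega⟩
    omega
  have hT := hS.remove hmin
  have hJ := defect_ofDefect hT
  set J := ofDefect hT
  have hmem : ∀ x y z, J.defect x y z ↔ I.defect x y z ∧ ¬ ((x = u ∧ y = v ∧ z = w) ∨
      (x = v ∧ y = w ∧ z = u) ∨ (x = w ∧ y = u ∧ z = v)) := by
    intro x y z
    rw [hJ]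
  have hJuvw : ¬ J.defect u v w := fun h => ((hmem u v w).1 h).2 (Or.inl ⟨rfl, rfl, rfl⟩)
  refine ⟨J, ⟨?_, ?_⟩, ?_⟩
  · intro heq
    exact hJuvw (heq ▸ huvw)
  · obtain ⟨hs, a, ha, rfl, rfl, rfl⟩ := huvw
    have haJ : a ∈ J.ideal := by
      by_contra h
      exact hJuvw ⟨hs, a, h, rfl, rfl, rfl⟩
    refine ⟨a, haJ, ?_⟩
    have horb : ∀ b : Cube r, b ∈ a.orbit ↔ ((b.1 : ℤ) + 1 - r = (a.1 : ℤ) + 1 - r ∧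
        (b.2.1 : ℤ) + 1 - r = (a.2.1 : ℤ) + 1 - r ∧ (b.2.2 : ℤ) + 1 - r = (a.2.2 : ℤ) + 1 - r) ∨
        ((b.1 : ℤ) + 1 - r = (a.2.1 : ℤ) + 1 - r ∧
        (b.2.1 : ℤ) + 1 - r = (a.2.2 : ℤ) + 1 - r ∧ (b.2.2 : ℤ) + 1 - r = (a.1 : ℤ) + 1 - r) ∨
        ((b.1 : ℤ) + 1 - r = (a.2.2 : ℤ) + 1 - r ∧
        (b.2.1 : ℤ) + 1 - r = (a.1 : ℤ) + 1 - r ∧ (b.2.2 : ℤ) + 1 - r = (a.2.1 : ℤ) + 1 - r) := by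
      intro b
      simp only [Cube.orbit, Cube.rot, Set.mem_insert_iff, Set.mem_singleton_iff, Prod.ext_iff,
        Fin.ext_iff]
      omega
    -- The flip is checked on the lower half only; self-complementarity transfers it to the upper
    -- half.
    have hlow : ∀ b : Cube r, (b.1 : ℤ) + b.2.1 + b.2.2 + 2 ≤ 3 * r →
        (b ∈ I.ideal ↔ b ∈ J.ideal ∧ b ∉ a.orbit) := by
      intro b hb
      have h1 := I.defect_coe b
      have h2 := J.defect_coe b
      rw [hmem, ← horb, h1] at h2
      have h3 : b ∈ a.orbit → b ∉ I.ideal := by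
        rintro (rfl | rfl | rfl)
        · exact ha
        · exact I.not_mem_of_rot_not_mem ha
        · exact I.not_mem_of_rot_not_mem (I.not_mem_of_rot_not_mem ha)
      tauto
    have horbs : ∀ b ∈ a.orbit, (b.1 : ℤ) + b.2.1 + b.2.2 + 2 ≤ 3 * r := by
      intro b hb
      have := (horb b).1 hb
      omega
    ext b
    change b ∈ I.ideal ↔ (b ∈ J.ideal ∧ b ∉ a.orbit) ∨ b ∈ Cube.dual '' a.orbit
    have hdual : b ∈ Cube.dual '' a.orbit ↔ b.dual ∈ a.orbit := by
      constructor
      · rintro ⟨c, hc, rfl⟩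
        rwa [Cube.dual_dual]
      · exact fun h => ⟨_, h, Cube.dual_dual b⟩
    have hd := dual_coords b
    rw [hdual]
    by_cases hb : (b.1 : ℤ) + b.2.1 + b.2.2 + 2 ≤ 3 * r
    · have : b.dual ∉ a.orbit := fun h => by
        have := horbs _ h
        omega
      rw [hlow b hb]
      tauto
    · have h1 : b ∉ a.orbit := fun h => hb (horbs _ h)
      have h2 := hlow b.dual (by omega)
      rw [I.selfComplementary b, J.selfComplementary b]
      tauto
  · refine card_lt_card ((IsDefect.ringIndices_mono ?_).ssubset_of_ne ?_)
    · exact fun x y z h => ((hmem x y z).1 h).1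
    · intro heq
      exact hJuvw (hS.of_ringIndices_subset J.isDefect_defect heq.ge huvw)

theorem exists_walk_length_le (I : CSSCIdeal r) :
    ∃ p : (flipGraph r).Walk (center r) I, p.length ≤ I.defectCard := by
  induction hn : I.defectCard using Nat.strong_induction_on generalizing I with
  | _ n ih =>
    by_cases hI : I = center r
    · subst hI
      exact ⟨.nil, by simp⟩
    · obtain ⟨J, hJ, hlt⟩ := exists_adj_defectCard_lt hI
      obtain ⟨p, hp⟩ := ih _ (hn ▸ hlt) J rfl
      refine ⟨p.concat hJ, ?_⟩
      rw [SimpleGraph.Walk.length_concat]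
      omega

theorem dist_center (I : CSSCIdeal r) : (flipGraph r).dist (center r) I = I.defectCard := by
  obtain ⟨p, hp⟩ := I.exists_walk_length_le
  refine le_antisymm ((SimpleGraph.dist_le p).trans hp) ?_
  obtain ⟨q, hq⟩ := p.reachable.exists_walk_length_eq_dist
  have := defectCard_le_length q
  rw [defectCard_center] at this
  omega

theorem flipGraph_connected : (flipGraph r).Connected := by
  have h : ∀ I : CSSCIdeal r, (flipGraph r).Reachable (center r) I := fun I =>
    I.exists_walk_length_le.choose.reachable
  exact { preconnected := fun I J => (h I).symm.trans (h J), nonempty := ⟨center r⟩ }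

/-! ### Counting the extremal ideals. -/

/-- The ideal at maximal distance from the center given by a sequence of choices. -/
def extremal (c : Fin (r - 1) → Fin 3) : CSSCIdeal r :=
  -- Only the choices at `1, ..., r - 1` affect the defect, hence the shift by one; the values given
  -- elsewhere are immaterial.
  ofDefect (isDefect_apexDefect r fun k => if h : k - 1 < r - 1 then c ⟨k - 1, h⟩ else 0)

theorem extremal_injective : Function.Injective (extremal (r := r)) := by
  intro c c' h
  have h' := congrArg defect h
  rw [extremal, extremal, defect_ofDefect, defect_ofDefect] at h'
  funext i
  have := choice_eq_of_apexDefect_eq h' (k := i + 1) (by omega) (by omega)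
  simpa using this

theorem range_extremal : Set.range (extremal (r := r)) =
    {I | I.defectCard = ∑ k ∈ range (r + 1), k.choose 2} := by
  ext I
  constructor
  · rintro ⟨c, rfl⟩
    rw [Set.mem_ofPred_eq, defectCard, extremal, defect_ofDefect, card_ringIndices_apexDefect]
  · intro hI
    obtain ⟨c, hc⟩ := I.isDefect_defect.exists_eq_apexDefect hI
    refine ⟨fun i => c (i + 1), defect_injective ?_⟩
    rw [extremal, defect_ofDefect, hc]
    refine apexDefect_congr fun k hk hkr => ?_
    rw [dif_pos (by omega), Nat.sub_add_cancel hk]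

end CSSCIdeal

theorem sum_choose_two_cast (r : ℕ) :
    ((∑ k ∈ range (r + 1), k.choose 2 : ℕ) : ℚ) = ((r : ℚ) - 1) * r * (r + 1) / 6 := by
  induction r with
  | zero => simp
  | succ r ih =>
    rw [sum_range_succ, Nat.cast_add, ih, Nat.cast_choose_two]
    push_cast
    ring

theorem theorem4p9 (r : ℕ) (hr : 1 ≤ r) :
    (CSSCIdeal.flipGraph r).Connected ∧
    IsGreatest
      (Set.range fun I : CSSCIdeal r =>
        ((CSSCIdeal.flipGraph r).dist (CSSCIdeal.center r) I : ℚ))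
      (((r : ℚ) - 1) * r * (r + 1) / 6) ∧
    {I : CSSCIdeal r |
        ((CSSCIdeal.flipGraph r).dist (CSSCIdeal.center r) I : ℚ) =
          ((r : ℚ) - 1) * r * (r + 1) / 6}.ncard = 3 ^ (r - 1) := by
  have hext : ∀ I : CSSCIdeal r, ((CSSCIdeal.flipGraph r).dist (CSSCIdeal.center r) I : ℚ) =
      ((r : ℚ) - 1) * r * (r + 1) / 6 ↔ I ∈ Set.range (CSSCIdeal.extremal (r := r)) := by
    intro I
    rw [CSSCIdeal.range_extremal, Set.mem_ofPred_eq, ← sum_choose_two_cast,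
      CSSCIdeal.dist_center, Nat.cast_inj]
  refine ⟨CSSCIdeal.flipGraph_connected, ⟨?_, ?_⟩, ?_⟩
  · exact ⟨CSSCIdeal.extremal fun _ => 0, (hext _).2 ⟨_, rfl⟩⟩
  · rintro _ ⟨I, rfl⟩
    dsimp only
    rw [← sum_choose_two_cast, CSSCIdeal.dist_center, Nat.cast_le]
    exact I.isDefect_defect.card_ringIndices_le
  · simp only [hext, Set.ofPred_mem_eq]
    rw [← Set.image_univ, Set.ncard_image_of_injective _ CSSCIdeal.extremal_injective,
      Set.ncard_univ]
    simp
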